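/- **Setting.** Consider a discounted MDP with finite state space $\mathcal S$, finite action space $\mathcal A$, transition function $P:\mathcal S\times\mathcal A\to\Delta(\mathcal S)$, deterministic reward $R:\mathcal S\times\mathcal A\to[0,R_{\max}]$, discount factor $\gamma\in[0,1)$ and fixed initial state $s_0$. Put $V_{\max}=R_{\max}/(1-\gamma)$. A policy $\pi:\mathcal S\to\Delta(\mathcal A)$ induces a random trajectory $s_0,a_0,s_1,a_1,\dots$ with $a_t\sim\pi(\cdot|s_t)$ and $s_{t+1}\sim P(\cdot|s_t,a_t)$. Let $$J(\pi)=\mathbb E\Big[\sum_{t\ge0}\gamma^tR(s_t,a_t)\,\Big|\,\pi\Big],\qquad d_\pi(s,a)=(1-\gamma)\,\mathbb E\Big[\sum_{t\ge0}\gamma^t\mathbf 1[s_t=s,a_t=a]\,\Big|\,\pi\Big].$$ Write $f(s,\pi)=\sum_a\pi(a|s)f(s,a)$, $(\mathcal T^\pi f)(s,a)=R(s,a)+\gamma\,\mathbb E_{s'\sim P(\cdot|s,a)}[f(s',\pi)]$ and $\|g\|_{2,\nu}^2=\mathbb E_\nu[g^2]$. Let $\Pi$ be a finite non-empty set of policies,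 $\mathcal F$ a finite non-empty set of functions $\mathcal S\times\mathcal A\to[0,V_{\max}]$, and $\mu$ a distribution on $\mathcal S\times\mathcal A$. Let $\varepsilon_{\mathcal F},\varepsilon_{\mathcal F,\mathcal F}$ be such that for every $\pi\in\Pi$ $$\inf_{f\in\mathcal F}\ \sup_{\pi'\in\Pi}\|f-\mathcal T^\pi f\|_{2,d_{\pi'}}^2\le\varepsilon_{\mathcal F},\qquad \sup_{f\in\mathcal F}\ \inf_{f'\in\mathcal F}\|f'-\mathcal T^\pi f\|_{2,\mu}^2\le\varepsilon_{\mathcal F,\mathcal F}.$$ **Algorithm.** Let $\mathcal D$ consist of $n\ge1$ i.i.d. tuples $(s,a,r,s')$ with $(s,a)\sim\mu$, $r=R(s,a)$, $s'\sim P(\cdot|s,a)$. Define $$\mathcal L(f',f,\pi;\mathcal D)=\frac1n\sum_{(s,a,r,s')\in\mathcal D}\big(f'(s,a)-r-\gamma f(s',\pi)\big)^2,\qquad \mathcal E(f,\pi;\mathcal D)=\mathcal L(f,f,\pi;\mathcal D)-\min_{f'\in\mathcal F}\mathcal L(f',f,\pi;\mathcal D).$$ For $\delta\in(0,1)$ let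 $$\varepsilon_r=\frac{139\,V_{\max}^2\log\frac{|\mathcal F||\Pi|}{\delta}}{n}+39\,\varepsilon_{\mathcal F},\qquad \hat\pi\in\operatorname*{argmax}_{\pi\in\Pi}\ \min\{f(s_0,\pi):f\in\mathcal F,\ \mathcal E(f,\pi;\mathcal D)\le\varepsilon_r\},$$ where a minimum over the empty set is $+\infty$. **Corollary (Bounded degradation from behavior policy).** There is a universal constant $C>0$ such that, in every such setting, if $\mu=d_{\pi_b}$ for some $\pi_b\in\Pi$, then with probability at least $1-\delta$ over $\mathcal D$, every such maximizer $\hat\pi$ satisfies $$J(\pi_b)-J(\hat\pi)\le C\left(\frac{V_{\max}}{1-\gamma}\sqrt{\frac{\log\frac{|\mathcal F||\Pi|}{\delta}}{n}}+\frac{\sqrt{\varepsilon_{\mathcal F,\mathcal F}+\varepsilon_{\mathcal F}}}{1-\gamma}\right).$$ -/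

import Mathlib

open MeasureTheory ProbabilityTheory Finset

/-- A discounted Markov decision process with finite state space `S`, finite action space `A`,
deterministic rewards in `[0, Rmax]` and a deterministic initial state. -/
structure MDP (S A : Type*) where
  /-- transition function -/
  P : S → A → PMF S
  /-- reward function -/
  R : S → A → ℝ
  /-- upper bound on the rewards -/
  Rmax : ℝ
  R_mem : ∀ s a, R s a ∈ Set.Icc 0 Rmax
  /-- discount factor -/
  γ : ℝ
  γ_nonneg : 0 ≤ γ
  γ_lt_one : γ < 1
  /-- initial state -/
  s₀ : S

/-- Stochastic policies. -/
abbrev Policy (S A : Type*) := S → PMF A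

/-- A dataset of `n` tuples `(s, a, r, s')`. -/
abbrev Dataset (S A : Type*) (n : ℕ) := Fin n → S × A × ℝ × S

noncomputable section

namespace MDP

section Kernels

variable {S A : Type*} [Fintype S] [Fintype A] [MeasurableSpace S] [MeasurableSingletonClass S]
  [MeasurableSpace A] [MeasurableSingletonClass A]

/-- The policy as a Markov kernel from states to actions. -/
def policyKernel (π : Policy S A) : Kernel S A :=
  Kernel.ofFunOfCountable fun s => (π s).toMeasure

instance (π : Policy S A) : IsMarkovKernel (policyKernel π) :=
  ⟨fun s => inferInstanceAs (IsProbabilityMeasure (π s).toMeasure)⟩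

/-- The transition function as a Markov kernel. -/
def transKernel (M : MDP S A) : Kernel (S × A) S :=
  Kernel.ofFunOfCountable fun x => (M.P x.1 x.2).toMeasure

instance (M : MDP S A) : IsMarkovKernel M.transKernel :=
  ⟨fun x => inferInstanceAs (IsProbabilityMeasure (M.P x.1 x.2).toMeasure)⟩

/-- One step under `π`: from `(s, a)`, draw `s' ∼ P(· | s, a)` and then `a' ∼ π(· | s')`. -/
def stepKernel (M : MDP S A) (π : Policy S A) : Kernel (S × A) (S × A) :=
  M.transKernel ⊗ₖ Kernel.prodMkLeft (S × A) (policyKernel π)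

instance (M : MDP S A) (π : Policy S A) : IsMarkovKernel (M.stepKernel π) :=
  inferInstanceAs (IsMarkovKernel (_ ⊗ₖ _))

/-- The law of `(s_0, a_0)`, where `s_0` is the initial state and `a_0 ∼ π(· | s_0)`. -/
def initLaw (M : MDP S A) (π : Policy S A) : Measure (S × A) :=
  Measure.dirac M.s₀ ⊗ₘ policyKernel π

instance (M : MDP S A) (π : Policy S A) : IsProbabilityMeasure (M.initLaw π) :=
  inferInstanceAs (IsProbabilityMeasure (_ ⊗ₘ _))

/-- The law of the random trajectory `(s_0, a_0), (s_1, a_1), …` induced by `π`. -/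
def trajLaw (M : MDP S A) (π : Policy S A) : Measure (ℕ → S × A) :=
  Kernel.trajMeasure (X := fun _ => S × A) (M.initLaw π) fun t =>
    (M.stepKernel π).comap (fun h : (i : Finset.Iic t) → S × A => h ⟨t, Finset.mem_Iic.2 le_rfl⟩)
      (measurable_pi_apply _)

/-- The expected discounted return `J(π) = E[∑ γ^t r_t | π]`. -/
def J (M : MDP S A) (π : Policy S A) : ℝ :=
  ∫ τ, ∑' t : ℕ, M.γ ^ t * M.R (τ t).1 (τ t).2 ∂(M.trajLaw π)

open Classical in
/-- The discounted occupancy `d_π(s, a) = (1 - γ) E[∑ γ^t 1[s_t = s, a_t = a] | π]`. -/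
def occupancy (M : MDP S A) (π : Policy S A) (x : S × A) : ℝ :=
  (1 - M.γ) * ∫ τ, ∑' t : ℕ, M.γ ^ t * (if τ t = x then 1 else 0) ∂(M.trajLaw π)

/-- The law of one data tuple: `(s, a) ∼ μ`, `r = R(s, a)`, `s' ∼ P(· | s, a)`. -/
def dataLaw (M : MDP S A) (μ : PMF (S × A)) : Measure (S × A × ℝ × S) :=
  (μ.toMeasure ⊗ₘ M.transKernel).map fun z => (z.1.1, z.1.2, M.R z.1.1 z.1.2, z.2)

end Kernels

section Bellman

variable {S A : Type*} [Fintype S] [Fintype A]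

/-- `V_max = R_max / (1 - γ)`. -/
def Vmax (M : MDP S A) : ℝ := M.Rmax / (1 - M.γ)

/-- `f(s, π) = E_{a ∼ π(· | s)} [f(s, a)]`. -/
def valueAt (f : S × A → ℝ) (s : S) (π : Policy S A) : ℝ :=
  ∑ a, (π s a).toReal * f (s, a)

/-- The Bellman operator `(T^π f)(s, a) = R(s, a) + γ E_{s' ∼ P(· | s, a)} [f(s', π)]`. -/
def bellman (M : MDP S A) (π : Policy S A) (f : S × A → ℝ) (x : S × A) : ℝ :=
  M.R x.1 x.2 + M.γ * ∑ s', (M.P x.1 x.2 s').toReal * valueAt f s' π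

/-- The weighted squared 2-norm `‖g‖²_{2,ν} = E_ν[g²]`. -/
def sqNorm (ν g : S × A → ℝ) : ℝ := ∑ x, ν x * g x ^ 2

variable [MeasurableSpace S] [MeasurableSingletonClass S] [MeasurableSpace A]
  [MeasurableSingletonClass A]

/-- Approximate realizability: for every `π ∈ Pi`,
`inf_{f ∈ F} sup_{ν admissible} ‖f - T^π f‖²_{2,ν} ≤ εF`, where the admissible distributions are
the occupancies `d_{π'}` of the policies `π' ∈ Pi`. -/
def Realizability (M : MDP S A) (F : Finset (S × A → ℝ)) (hF : F.Nonempty)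
    (Pi : Finset (Policy S A)) (hPi : Pi.Nonempty) (εF : ℝ) : Prop :=
  ∀ π ∈ Pi, F.inf' hF (fun f =>
    Pi.sup' hPi fun π' => sqNorm (M.occupancy π') (f - M.bellman π f)) ≤ εF

/-- Approximate completeness: for every `π ∈ Pi`,
`sup_{f ∈ F} inf_{f' ∈ F} ‖f' - T^π f‖²_{2,μ} ≤ εFF`. -/
def Completeness (M : MDP S A) (μ : PMF (S × A)) (F : Finset (S × A → ℝ)) (hF : F.Nonempty)
    (Pi : Finset (Policy S A)) (εFF : ℝ) : Prop :=
  ∀ π ∈ Pi, F.sup' hF (fun f =>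
    F.inf' hF fun f' => sqNorm (fun x => (μ x).toReal) (f' - M.bellman π f)) ≤ εFF

end Bellman

section Algorithm

variable {S A : Type*} [Fintype S] [Fintype A] {n : ℕ}

/-- `L(f', f, π; D) = (1/n) ∑_{(s,a,r,s') ∈ D} (f'(s,a) - r - γ f(s',π))²`. -/
def loss (M : MDP S A) (f' f : S × A → ℝ) (π : Policy S A) (D : Dataset S A n) : ℝ :=
  (1 / (n : ℝ)) * ∑ i, (f' ((D i).1, (D i).2.1) - (D i).2.2.1
    - M.γ * valueAt f (D i).2.2.2 π) ^ 2

/-- The estimated Bellman error `E(f, π; D) = L(f, f, π; D) - min_{f' ∈ F} L(f', f, π; D)`. -/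
def empBellmanError (M : MDP S A) (F : Finset (S × A → ℝ)) (hF : F.Nonempty)
    (f : S × A → ℝ) (π : Policy S A) (D : Dataset S A n) : ℝ :=
  M.loss f f π D - F.inf' hF fun f' => M.loss f' f π D

/-- The version space `F_{π,ε} = {f ∈ F : E(f, π; D) ≤ ε}`. -/
def versionSpace (M : MDP S A) (F : Finset (S × A → ℝ)) (hF : F.Nonempty)
    (π : Policy S A) (ε : ℝ) (D : Dataset S A n) : Set (S × A → ℝ) :=
  {f | f ∈ F ∧ M.empBellmanError F hF f π D ≤ ε}

/-- The pessimistic value `min_{f ∈ F_{π,ε}} f(s₀, π)`; a minimum over the empty set is `+∞`. -/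
def pessimisticValue (M : MDP S A) (F : Finset (S × A → ℝ)) (hF : F.Nonempty)
    (π : Policy S A) (ε : ℝ) (D : Dataset S A n) : EReal :=
  ⨅ f ∈ M.versionSpace F hF π ε D, ((valueAt f M.s₀ π : ℝ) : EReal)

/-- `π̂ ∈ argmax_{π ∈ Pi} min_{f ∈ F_{π,ε}} f(s₀, π)`. -/
def IsPessimisticPolicy (M : MDP S A) (F : Finset (S × A → ℝ)) (hF : F.Nonempty)
    (Pi : Finset (Policy S A)) (ε : ℝ) (D : Dataset S A n) (πhat : Policy S A) : Prop :=
  πhat ∈ Pi ∧ ∀ π ∈ Pi, M.pessimisticValue F hF π ε D ≤ M.pessimisticValue F hF πhat ε D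

/-- The threshold `ε_r = 139 V_max² log(|F||Pi|/δ) / n + 39 εF`. -/
def epsR (M : MDP S A) (F : Finset (S × A → ℝ)) (Pi : Finset (Policy S A))
    (n : ℕ) (δ εF : ℝ) : ℝ :=
  139 * M.Vmax ^ 2 * Real.log ((#F : ℝ) * (#Pi : ℝ) / δ) / n + 39 * εF

end Algorithm

end MDP

end

noncomputable section

namespace MDP

/-! For every function `f`, summing `f - T^π f` against `d_π` telescopes to `(1 - γ)(f(s₀, π) -
J(π))` (`sum_occupancy_mul_bellmanError`). By Jensen, a small Bellman error under `d_π` therefore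
places `f(s₀, π)` close to `J(π)`. Two facts about the version spaces then suffice (`J_sub_J_le`).
The version space of `πhat` contains a near-fixed point `fstar πhat`, so the pessimistic value of
`πhat` is at most about `J(πhat)`. Every member of the version space of `πb` has small Bellman error
under `μ = d_πb`, so the pessimistic value of `πb` is at least about `J(πb)`. Maximality of `πhat`
links the two. Realizability takes the supremum over occupancies for one fixed `f`; hence the same
`fstar π` is accurate under `μ`, where it must pass the empirical test, and under `d_π`, where its
value is read off.

Both facts hold simultaneously for all policies in `Pi` by a union bound (`exists_measureReal_le`).
Given `(s, a)`, the loss difference has mean `a² - b²`, where `a`, `b` are the Bellman residuals of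
`f` and `f'`, and its noise is proportional to `a - b`. Conditional Hoeffding thus bounds its
exponential moment in terms of `a²` and `b²` alone, and Chernoff gives deviations of the fast order
`1/n`, which the final square root turns into `1/√n`. -/

lemma sqNorm_nonneg {S A : Type*} [Fintype S] [Fintype A] {ν : S × A → ℝ} (hν : ∀ x, 0 ≤ ν x)
    (g : S × A → ℝ) : 0 ≤ sqNorm ν g :=
  sum_nonneg fun x _ => mul_nonneg (hν x) (sq_nonneg _)

/-! ### Trajectory laws, occupancies and the telescoping identity. -/

section Trajectories

variable {S A : Type*} [Fintype S] [Fintype A] [MeasurableSpace S] [MeasurableSingletonClass S]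
  [MeasurableSpace A] [MeasurableSingletonClass A]

instance (M : MDP S A) (π : Policy S A) : IsProbabilityMeasure (M.trajLaw π) := by
  unfold trajLaw; infer_instance

lemma integral_policyKernel (π : Policy S A) (s : S) (f : A → ℝ) :
    ∫ a, f a ∂(policyKernel π s) = ∑ a, (π s a).toReal * f a := by
  change ∫ a, f a ∂((π s).toMeasure) = _
  simp [PMF.integral_eq_sum]

lemma integral_transKernel (M : MDP S A) (x : S × A) (f : S → ℝ) :
    ∫ s, f s ∂(M.transKernel x) = ∑ s, (M.P x.1 x.2 s).toReal * f s := by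
  change ∫ s, f s ∂((M.P x.1 x.2).toMeasure) = _
  simp [PMF.integral_eq_sum]

/-- The expectation of `f (s', a')` after one step from `x` under `π`. -/
def nextValue (M : MDP S A) (π : Policy S A) (f : S × A → ℝ) (x : S × A) : ℝ :=
  ∑ s', (M.P x.1 x.2 s').toReal * valueAt f s' π

lemma integral_stepKernel (M : MDP S A) (π : Policy S A) (f : S × A → ℝ) (x : S × A) :
    ∫ y, f y ∂(M.stepKernel π x) = M.nextValue π f x := by
  rw [stepKernel, ProbabilityTheory.integral_compProd .of_finite, integral_transKernel]
  simp [nextValue, valueAt, integral_policyKernel]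

lemma integral_initLaw (M : MDP S A) (π : Policy S A) (f : S × A → ℝ) :
    ∫ y, f y ∂(M.initLaw π) = valueAt f M.s₀ π := by
  rw [initLaw, Measure.integral_compProd .of_finite]
  simp [valueAt, integral_policyKernel]

lemma map_zero_trajLaw (M : MDP S A) (π : Policy S A) :
    (M.trajLaw π).map (fun τ => τ 0) = M.initLaw π := by
  have h : (M.trajLaw π).map (fun τ => τ 0) = ((M.trajLaw π).map (Preorder.frestrictLe 0)).map
      (fun h : (i : Finset.Iic 0) → S × A => h ⟨0, Finset.mem_Iic.2 le_rfl⟩) := by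
    rw [Measure.map_map (by fun_prop) (by fun_prop)]
    rfl
  rw [h, trajLaw, Kernel.trajMeasure, Measure.map_comp _ _ (by fun_prop),
    Kernel.traj_map_frestrictLe, Kernel.partialTraj_self, Measure.id_comp,
    Measure.map_map (by fun_prop) (by fun_prop)]
  exact Measure.map_id

lemma integral_trajLaw_zero (M : MDP S A) (π : Policy S A) (f : S × A → ℝ) :
    ∫ τ, f (τ 0) ∂(M.trajLaw π) = valueAt f M.s₀ π := by
  rw [← integral_initLaw, ← map_zero_trajLaw, integral_map (measurable_pi_apply 0).aemeasurable]
  exact (Measurable.of_discrete).aestronglyMeasurable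

lemma integrable_trajLaw (M : MDP S A) (π : Policy S A) (f : S × A → ℝ) (t : ℕ) :
    Integrable (fun τ : ℕ → S × A => f (τ t)) (M.trajLaw π) := by
  have hf : Measurable f := .of_discrete
  exact .of_bound (hf.comp (measurable_pi_apply t)).aestronglyMeasurable (∑ y, ‖f y‖) (ae_of_all _ fun τ =>
    single_le_sum (f := fun x => ‖f x‖) (fun _ _ => norm_nonneg _) (mem_univ (τ t)))

/-- The Markov property: the transition kernel given the whole history reads only its last
coordinate. -/
lemma integral_trajLaw_succ (M : MDP S A) (π : Policy S A) (f : S × A → ℝ) (t : ℕ) :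
    ∫ τ, f (τ (t + 1)) ∂(M.trajLaw π) = ∫ τ, M.nextValue π f (τ t) ∂(M.trajLaw π) := by
  have hf : Measurable f := .of_discrete
  have hm := Kernel.map_frestrictLe_trajMeasure_compProd_eq_map_trajMeasure
    (X := fun _ => S × A) (μ₀ := M.initLaw π) (κ := fun t =>
    (M.stepKernel π).comap (fun h : (i : Finset.Iic t) → S × A => h ⟨t, Finset.mem_Iic.2 le_rfl⟩)
      (measurable_pi_apply _)) (a := t)
  change (M.trajLaw π).map _ ⊗ₘ _ = (M.trajLaw π).map _ at hm
  have h1 : ∫ τ, f (τ (t + 1)) ∂(M.trajLaw π) =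
      ∫ z, f z.2 ∂((M.trajLaw π).map (fun x ↦ (Preorder.frestrictLe t x, x (t + 1)))) := by
    rw [integral_map (by fun_prop) (by fun_prop)]
  rw [h1, ← hm, Measure.integral_compProd]
  · simp only [Kernel.comap_apply, integral_stepKernel]
    rw [integral_map (by fun_prop)]
    · rfl
    · have : Measurable (M.nextValue π f) := .of_discrete
      exact (this.comp (measurable_pi_apply _)).aestronglyMeasurable
  · have : IsProbabilityMeasure ((M.trajLaw π).map (Preorder.frestrictLe t)) :=
      Measure.isProbabilityMeasure_map (by fun_prop)
    refine Integrable.of_bound (by fun_prop) (∑ x, ‖f x‖) (ae_of_all _ fun z => ?_)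
    exact single_le_sum (f := fun x => ‖f x‖) (fun _ _ => norm_nonneg _) (mem_univ z.2)

/-- The expected discounted sum of `f` along a trajectory. -/
def discountedSum (M : MDP S A) (π : Policy S A) (f : S × A → ℝ) : ℝ :=
  ∫ τ, ∑' t : ℕ, M.γ ^ t * f (τ t) ∂(M.trajLaw π)

/-- Sum and expectation commute because `f` is bounded on a finite type and the weights are
geometric. -/
lemma hasSum_discountedSum (M : MDP S A) (π : Policy S A) (f : S × A → ℝ) :
    HasSum (fun t : ℕ => M.γ ^ t * ∫ τ, f (τ t) ∂(M.trajLaw π)) (M.discountedSum π f) := by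
  have hb : ∀ x, ‖f x‖ ≤ ∑ y, ‖f y‖ := fun x =>
    single_le_sum (f := fun x => ‖f x‖) (fun _ _ => norm_nonneg _) (mem_univ x)
  have hi := M.integrable_trajLaw π f
  simp_rw [← integral_const_mul]
  refine hasSum_integral_of_summable_integral_norm (fun t => (hi t).const_mul _) ?_
  refine .of_nonneg_of_le (fun t => by positivity) (fun t => ?_)
    ((summable_geometric_of_lt_one M.γ_nonneg M.γ_lt_one).mul_right (∑ y, ‖f y‖))
  calc ∫ τ, ‖M.γ ^ t * f (τ t)‖ ∂(M.trajLaw π)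
      ≤ ∫ _, M.γ ^ t * ∑ y, ‖f y‖ ∂(M.trajLaw π) := by
        refine integral_mono ((hi t).const_mul _).norm (integrable_const _) fun τ => ?_
        rw [norm_mul, Real.norm_of_nonneg (pow_nonneg M.γ_nonneg t)]
        exact mul_le_mul_of_nonneg_left (hb _) (pow_nonneg M.γ_nonneg t)
    _ = _ := by simp

/-- Split off the term `t = 0` and shift the rest by the Markov property; this is the source of the
telescoping. -/
lemma discountedSum_eq (M : MDP S A) (π : Policy S A) (f : S × A → ℝ) :
    M.discountedSum π f = valueAt f M.s₀ π + M.γ * M.discountedSum π (M.nextValue π f) := by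
  have h := (M.hasSum_discountedSum π f)
  rw [← hasSum_nat_add_iff' 1] at h
  have h2 := (M.hasSum_discountedSum π (M.nextValue π f)).mul_left M.γ
  have h3 := h.unique (h2.congr_fun fun t => by rw [integral_trajLaw_succ]; ring)
  simp [integral_trajLaw_zero] at h3
  linarith

lemma sum_occupancy_mul (M : MDP S A) (π : Policy S A) (f : S × A → ℝ) :
    ∑ x, M.occupancy π x * f x = (1 - M.γ) * M.discountedSum π f := by
  classical
  have h : HasSum (fun t : ℕ => M.γ ^ t * ∫ τ, f (τ t) ∂(M.trajLaw π))
      (∑ x, M.discountedSum π (fun y => if y = x then 1 else 0) * f x) := by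
    refine (hasSum_sum fun x _ => (M.hasSum_discountedSum π
      (fun y => if y = x then 1 else 0)).mul_right (f x)).congr_fun fun t => ?_
    simp_rw [mul_assoc, ← mul_sum, ← integral_mul_const]
    rw [← integral_finsetSum _ fun x _ => (M.integrable_trajLaw π
      (fun y => if y = x then 1 else 0) t).mul_const (f x)]
    simp
  rw [(M.hasSum_discountedSum π f).unique h, mul_sum]
  refine sum_congr rfl fun x _ => ?_
  rw [occupancy, discountedSum, mul_assoc]

lemma occupancy_nonneg (M : MDP S A) (π : Policy S A) (x : S × A) : 0 ≤ M.occupancy π x := by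
  have h1 := M.γ_nonneg
  have h2 := M.γ_lt_one
  refine mul_nonneg (by linarith) (integral_nonneg fun τ => tsum_nonneg fun t => ?_)
  split_ifs <;> simp [pow_nonneg h1]

lemma sum_occupancy (M : MDP S A) (π : Policy S A) : ∑ x, M.occupancy π x = 1 := by
  have h := M.sum_occupancy_mul π 1
  have h2 := M.hasSum_discountedSum π 1
  simp only [Pi.one_apply, integral_const, probReal_univ, smul_eq_mul, mul_one] at h h2
  rw [h, h2.unique (hasSum_geometric_of_lt_one M.γ_nonneg M.γ_lt_one), mul_inv_cancel₀]
  linarith [M.γ_lt_one]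

/-- The performance of a policy through the Bellman error of an arbitrary function. -/
lemma sum_occupancy_mul_bellmanError (M : MDP S A) (π : Policy S A) (f : S × A → ℝ) :
    ∑ x, M.occupancy π x * (f - M.bellman π f) x =
      (1 - M.γ) * (valueAt f M.s₀ π - M.J π) := by
  have hJ : M.J π = M.discountedSum π fun x => M.R x.1 x.2 := rfl
  have h : ∀ x, M.occupancy π x * (f - M.bellman π f) x = M.occupancy π x * f x -
      M.occupancy π x * M.R x.1 x.2 - M.γ * (M.occupancy π x * M.nextValue π f x) := fun x => by
    simp only [Pi.sub_apply, bellman, nextValue]; ring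
  simp_rw [h, sum_sub_distrib, ← mul_sum]
  rw [M.sum_occupancy_mul π f, M.sum_occupancy_mul π fun x => M.R x.1 x.2,
    M.sum_occupancy_mul π (M.nextValue π f), hJ, M.discountedSum_eq π f]
  ring

/-- Jensen's inequality for the square, `d_π` being a probability distribution. -/
lemma abs_valueAt_sub_J_le (M : MDP S A) (π : Policy S A) (f : S × A → ℝ) {ε : ℝ}
    (h : sqNorm (M.occupancy π) (f - M.bellman π f) ≤ ε) :
    |valueAt f M.s₀ π - M.J π| ≤ √ε / (1 - M.γ) := by
  have hγ : 0 < 1 - M.γ := by linarith [M.γ_lt_one]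
  rw [le_div_iff₀' hγ]
  nth_rewrite 1 [← abs_of_pos hγ]
  rw [← abs_mul, ← sum_occupancy_mul_bellmanError]
  refine Real.abs_le_sqrt (le_trans ?_ h)
  exact Real.pow_arith_mean_le_arith_mean_pow_of_even _ _ _ (fun x _ => M.occupancy_nonneg π x)
    (M.sum_occupancy π) even_two

end Trajectories

end MDP

/-! ### Elementary exponential inequalities and Chernoff's bound. -/

lemma PMF.sum_toReal {α : Type*} [Fintype α] (p : PMF α) : ∑ a, (p a).toReal = 1 := by
  have h : ∑ a, p a = 1 := by simpa using p.tsum_coe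
  rw [← ENNReal.toReal_sum fun a _ => p.apply_ne_top a, h, ENNReal.toReal_one]

lemma PMF.sum_toReal_mul_mem_Icc {α : Type*} [Fintype α] (p : PMF α) {g : α → ℝ} {b : ℝ}
    (hg : ∀ a, g a ∈ Set.Icc 0 b) : ∑ a, (p a).toReal * g a ∈ Set.Icc 0 b := by
  refine ⟨sum_nonneg fun a _ => mul_nonneg ENNReal.toReal_nonneg (hg a).1, ?_⟩
  calc ∑ a, (p a).toReal * g a ≤ ∑ a, (p a).toReal * b :=
        sum_le_sum fun a _ => mul_le_mul_of_nonneg_left (hg a).2 ENNReal.toReal_nonneg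
    _ = b := by rw [← sum_mul, p.sum_toReal, one_mul]

/-- By convexity the exponential lies below its chord on `[0, 2]`, and `e² ≤ 8`. -/
lemma Real.exp_two_mul_le {u : ℝ} (h₀ : 0 ≤ u) (h₁ : u ≤ 1) : Real.exp (2 * u) ≤ 1 + 7 * u := by
  have h := convexOn_exp.2 (Set.mem_univ 0) (Set.mem_univ 2) (sub_nonneg.2 h₁) h₀ (by ring)
  have h2 : Real.exp 2 ≤ 8 := by
    have := Real.exp_one_lt_d9
    have h3 : Real.exp 2 = Real.exp 1 * Real.exp 1 := by rw [← Real.exp_add]; norm_num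
    have := Real.exp_pos 1
    rw [h3]; nlinarith
  simp only [smul_eq_mul, mul_zero, zero_add, Real.exp_zero, mul_one] at h
  rw [mul_comm]
  nlinarith

/-- Apply `exp x ≤ 1 + x + x²` for `|x| ≤ 1` with `x = (3v - u)/4`, and bound `x² ≤ (9v + u)/16`.
The coefficient of `u` stays negative. -/
lemma Real.exp_three_mul_sub_div_four_le {u v : ℝ} (hu₀ : 0 ≤ u) (hu₁ : u ≤ 1) (hv₀ : 0 ≤ v)
    (hv₁ : v ≤ 1) : Real.exp ((3 * v - u) / 4) ≤ 1 + (21 / 16 * v - 3 / 16 * u) := by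
  have h := (abs_le.1 (Real.abs_exp_sub_one_sub_id_le (x := (3 * v - u) / 4)
    (abs_le.2 ⟨by linarith, by linarith⟩))).2
  nlinarith [mul_nonneg hu₀ hv₀]

/-- Chernoff's bound for a sum of independent identically distributed variables. -/
lemma measureReal_le_sum_le_exp {Ω Z : Type*} [MeasurableSpace Ω] [MeasurableSpace Z]
    {Pr : Measure Ω} [IsProbabilityMeasure Pr] {ν : Measure Z} {n : ℕ} {D : Fin n → Ω → Z}
    (hlaw : ∀ i, HasLaw (D i) ν Pr) (hindep : iIndepFun D Pr) [NeZero ν] {g : Z → ℝ}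
    (hg : Measurable g) (hint : Integrable (fun z => Real.exp (g z)) ν) {c : ℝ}
    (hc : ∫ z, Real.exp (g z) ∂ν ≤ Real.exp c) (t : ℝ) :
    Pr.real {ω | t ≤ ∑ i, g (D i ω)} ≤ Real.exp (n * c - t) := by
  have hae : ∀ i, AEMeasurable (g ∘ D i) Pr := fun i => hg.comp_aemeasurable (hlaw i).aemeasurable
  have hmgf : ∀ i, mgf (g ∘ D i) Pr 1 = ∫ z, Real.exp (g z) ∂ν := fun i => by
    rw [← (hlaw i).map_eq, integral_map (hlaw i).aemeasurable hg.exp.aestronglyMeasurable]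
    simp [mgf]
  have hpos : 0 < ∫ z, Real.exp (g z) ∂ν := integral_exp_pos hint
  have hsum : mgf (∑ i, g ∘ D i) Pr 1 = (∫ z, Real.exp (g z) ∂ν) ^ n := by
    rw [(hindep.comp _ fun _ => hg).mgf_sum₀ hae]
    simp [hmgf]
  have hI : Integrable (fun ω => Real.exp (1 * (∑ i, g ∘ D i) ω)) Pr := by
    -- A non-integrable function has integral `0` by convention, so positivity of the integral
    -- yields integrability.
    refine not_imp_comm.1 integral_undef (ne_of_gt ?_)
    change 0 < mgf (∑ i, g ∘ D i) Pr 1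
    rw [hsum]
    positivity
  have h := measure_ge_le_exp_mul_mgf t zero_le_one hI
  simp only [Finset.sum_apply, Function.comp_apply] at h
  rw [hsum] at h
  refine h.trans ?_
  calc Real.exp (-1 * t) * (∫ z, Real.exp (g z) ∂ν) ^ n
      ≤ Real.exp (-1 * t) * Real.exp c ^ n := by gcongr
    _ = Real.exp (n * c - t) := by rw [← Real.exp_nat_mul, ← Real.exp_add]; ring_nf

namespace MDP

/-! ### Range bounds for values and Bellman backups. -/

section Bounds

variable {S A : Type*}

lemma Rmax_nonneg (M : MDP S A) (π : Policy S A) : 0 ≤ M.Rmax := by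
  obtain ⟨a, -⟩ := (π M.s₀).support_nonempty
  exact (M.R_mem M.s₀ a).1.trans (M.R_mem M.s₀ a).2

lemma Vmax_nonneg (M : MDP S A) (π : Policy S A) : 0 ≤ M.Vmax :=
  div_nonneg (M.Rmax_nonneg π) (by linarith [M.γ_lt_one])

lemma Rmax_add_mul_Vmax (M : MDP S A) : M.Rmax + M.γ * M.Vmax = M.Vmax := by
  have : 1 - M.γ ≠ 0 := by linarith [M.γ_lt_one]
  rw [Vmax]
  field_simp
  ring

variable [Fintype A]

lemma valueAt_mem_Icc {f : S × A → ℝ} {b : ℝ} (hf : ∀ x, f x ∈ Set.Icc 0 b) (s : S)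
    (π : Policy S A) : valueAt f s π ∈ Set.Icc 0 b :=
  (π s).sum_toReal_mul_mem_Icc fun _ => hf _

/-- The difference of the squared temporal differences of `f` and `f'` at a data tuple. -/
def lossDiff (M : MDP S A) (f' f : S × A → ℝ) (π : Policy S A) (z : S × A × ℝ × S) : ℝ :=
  (f (z.1, z.2.1) - z.2.2.1 - M.γ * valueAt f z.2.2.2 π) ^ 2
    - (f' (z.1, z.2.1) - z.2.2.1 - M.γ * valueAt f z.2.2.2 π) ^ 2

lemma sum_lossDiff (M : MDP S A) {n : ℕ} (hn : 0 < n) (f' f : S × A → ℝ) (π : Policy S A)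
    (D : Dataset S A n) :
    ∑ i, M.lossDiff f' f π (D i) = n * (M.loss f f π D - M.loss f' f π D) := by
  have : (n : ℝ) ≠ 0 := by positivity
  simp only [lossDiff, sum_sub_distrib, loss]
  field_simp

variable [Fintype S]

lemma bellman_mem_Icc (M : MDP S A) (π : Policy S A) {f : S × A → ℝ}
    (hf : ∀ x, f x ∈ Set.Icc 0 M.Vmax) (x : S × A) : M.bellman π f x ∈ Set.Icc 0 M.Vmax := by
  have h1 := M.R_mem x.1 x.2
  have h2 := (M.P x.1 x.2).sum_toReal_mul_mem_Icc fun s => valueAt_mem_Icc hf s π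
  have h3 := mul_le_mul_of_nonneg_left h2.2 M.γ_nonneg
  have h4 := mul_nonneg M.γ_nonneg h2.1
  have h5 := M.Rmax_add_mul_Vmax
  rw [bellman]
  exact ⟨by linarith [h1.1], by linarith [h1.2]⟩

lemma sq_sub_bellman_div_mem_Icc (M : MDP S A) (π : Policy S A) {f f' : S × A → ℝ}
    (hf : ∀ x, f x ∈ Set.Icc 0 M.Vmax) (hf' : ∀ x, f' x ∈ Set.Icc 0 M.Vmax) (x : S × A) :
    (f' - M.bellman π f) x ^ 2 / M.Vmax ^ 2 ∈ Set.Icc 0 1 := by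
  have h1 := M.bellman_mem_Icc π hf x
  have h2 := hf' x
  refine ⟨by positivity, div_le_one_of_le₀ (sq_le_sq' ?_ ?_) (sq_nonneg _)⟩ <;>
  simp only [Pi.sub_apply] <;> linarith [h1.1, h1.2, h2.1, h2.2]

end Bounds

/-! ### Concentration of differences of empirical losses. -/

section Concentration

variable {S A : Type*} [Fintype S] [Fintype A] [MeasurableSpace S] [MeasurableSingletonClass S]
  [MeasurableSpace A] [MeasurableSingletonClass A]

lemma measurable_lossDiff (M : MDP S A) (f' f : S × A → ℝ) (π : Policy S A) :
    Measurable (M.lossDiff f' f π) := by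
  have h1 : Measurable f := .of_discrete
  have h2 : Measurable f' := .of_discrete
  have h3 : Measurable fun s => valueAt f s π := .of_discrete
  have h4 : Measurable fun z : S × A × ℝ × S => valueAt f z.2.2.2 π := h3.comp (by fun_prop)
  unfold lossDiff
  fun_prop

lemma measurable_dataTuple (M : MDP S A) :
    Measurable fun z : (S × A) × S => (z.1.1, z.1.2, M.R z.1.1 z.1.2, z.2) := .of_discrete

instance (M : MDP S A) (μ : PMF (S × A)) : IsProbabilityMeasure (M.dataLaw μ) :=
  Measure.isProbabilityMeasure_map M.measurable_dataTuple.aemeasurable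

lemma integrable_dataLaw (M : MDP S A) (μ : PMF (S × A)) {g : S × A × ℝ × S → ℝ}
    (hg : Measurable g) : Integrable g (M.dataLaw μ) := by
  rw [dataLaw, integrable_map_measure hg.aestronglyMeasurable M.measurable_dataTuple.aemeasurable]
  exact .of_finite

lemma integral_dataLaw (M : MDP S A) (μ : PMF (S × A)) {g : S × A × ℝ × S → ℝ}
    (hg : Measurable g) : ∫ z, g z ∂(M.dataLaw μ) =
      ∑ x, (μ x).toReal * ∫ s, g (x.1, x.2, M.R x.1 x.2, s) ∂(M.transKernel x) := by
  rw [dataLaw, integral_map M.measurable_dataTuple.aemeasurable hg.aestronglyMeasurable,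
    Measure.integral_compProd .of_finite, PMF.integral_eq_sum]
  rfl

/-- Hoeffding's bound, conditionally on the state-action pair. -/
lemma integral_exp_mul_lossDiff_le (M : MDP S A) (f' : S × A → ℝ) {f : S × A → ℝ}
    (hf : ∀ x, f x ∈ Set.Icc 0 M.Vmax) (π : Policy S A) (l : ℝ) (x : S × A) :
    ∫ s, Real.exp (l * M.lossDiff f' f π (x.1, x.2, M.R x.1 x.2, s)) ∂(M.transKernel x) ≤
      Real.exp (l * ((f - M.bellman π f) x ^ 2 - (f' - M.bellman π f) x ^ 2) +
        l ^ 2 * ((f - M.bellman π f) x - (f' - M.bellman π f) x) ^ 2 * M.Vmax ^ 2 / 2) := by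
  have hV := M.Vmax_nonneg π
  have hb : ∀ s, M.γ * valueAt f s π ∈ Set.Icc 0 M.Vmax := fun s => by
    have h := valueAt_mem_Icc hf s π
    exact ⟨mul_nonneg M.γ_nonneg h.1, (mul_le_of_le_one_left h.1 M.γ_lt_one.le).trans h.2⟩
  have hE : ∫ s, M.γ * valueAt f s π ∂(M.transKernel x) = M.bellman π f x - M.R x.1 x.2 := by
    rw [integral_const_mul, integral_transKernel, bellman]; ring
  have hH := (hasSubgaussianMGF_of_mem_Icc (μ := M.transKernel x)
    (X := fun s => M.γ * valueAt f s π) Measurable.of_discrete.aemeasurable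
    -- Expanding the squares, `-2 * l * (a - b)` is the coefficient of the centred variable `γ f(s',
    -- π)` in `l * lossDiff`.
    (ae_of_all _ hb)).mgf_le (-2 * l * ((f - M.bellman π f) x - (f' - M.bellman π f) x))
  rw [hE] at hH
  have heq : ∀ s, Real.exp (l * M.lossDiff f' f π (x.1, x.2, M.R x.1 x.2, s)) =
      Real.exp (l * ((f - M.bellman π f) x ^ 2 - (f' - M.bellman π f) x ^ 2)) *
      Real.exp (-2 * l * ((f - M.bellman π f) x - (f' - M.bellman π f) x) *
        (M.γ * valueAt f s π - (M.bellman π f x - M.R x.1 x.2))) := fun s => by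
    rw [← Real.exp_add, lossDiff]
    simp only [Pi.sub_apply]
    ring_nf
  simp_rw [heq]
  rw [integral_const_mul, Real.exp_add]
  refine mul_le_mul_of_nonneg_left (hH.trans (Real.exp_le_exp.2 (le_of_eq ?_))) (Real.exp_pos _).le
  simp only [sub_zero, NNReal.coe_pow, NNReal.coe_div, coe_nnnorm, Real.norm_of_nonneg hV,
    NNReal.coe_ofNat]
  ring

variable {Ω : Type*} [MeasurableSpace Ω] {Pr : Measure Ω} [IsProbabilityMeasure Pr] {n : ℕ}
  {D : Fin n → Ω → S × A × ℝ × S}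

/-- Chernoff's bound for a difference of empirical losses, from a linear upper bound of the
conditional moment generating function of `lossDiff`. -/
lemma measureReal_le_mul_loss_sub_le (M : MDP S A) {μ : PMF (S × A)}
    (hlaw : ∀ i, HasLaw (D i) (M.dataLaw μ) Pr) (hindep : iIndepFun D Pr) (hn : 0 < n)
    {f f' : S × A → ℝ} (hf : ∀ x, f x ∈ Set.Icc 0 M.Vmax) (π : Policy S A) (l p q t : ℝ)
    (hl : ∀ x, Real.exp (l * ((f - M.bellman π f) x ^ 2 - (f' - M.bellman π f) x ^ 2) +
        l ^ 2 * ((f - M.bellman π f) x - (f' - M.bellman π f) x) ^ 2 * M.Vmax ^ 2 / 2) ≤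
      1 + (p * (f - M.bellman π f) x ^ 2 + q * (f' - M.bellman π f) x ^ 2)) :
    Pr.real {ω | t ≤ l * (M.loss f f π (fun i => D i ω) - M.loss f' f π (fun i => D i ω))} ≤
      Real.exp (n * (p * sqNorm (fun x => (μ x).toReal) (f - M.bellman π f) +
        q * sqNorm (fun x => (μ x).toReal) (f' - M.bellman π f) - t)) := by
  have hm : Measurable fun z => l * M.lossDiff f' f π z :=
    (M.measurable_lossDiff f' f π).const_mul l
  have hn' : (0 : ℝ) < n := by positivity
  have hc : ∫ z, Real.exp (l * M.lossDiff f' f π z) ∂(M.dataLaw μ) ≤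
      Real.exp (p * sqNorm (fun x => (μ x).toReal) (f - M.bellman π f) +
        q * sqNorm (fun x => (μ x).toReal) (f' - M.bellman π f)) := by
    rw [M.integral_dataLaw μ hm.exp]
    calc _ ≤ ∑ x, (μ x).toReal * (1 + (p * (f - M.bellman π f) x ^ 2 +
          q * (f' - M.bellman π f) x ^ 2)) := sum_le_sum fun x _ => mul_le_mul_of_nonneg_left
            ((M.integral_exp_mul_lossDiff_le f' hf π l x).trans (hl x)) ENNReal.toReal_nonneg
      _ = (p * sqNorm (fun x => (μ x).toReal) (f - M.bellman π f) +
          q * sqNorm (fun x => (μ x).toReal) (f' - M.bellman π f)) + 1 := by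
        simp only [sqNorm, mul_add, mul_one, sum_add_distrib, μ.sum_toReal, mul_sum]
        rw [add_comm]
        congr 2 <;> exact sum_congr rfl fun x _ => by ring
      _ ≤ _ := Real.add_one_le_exp _
  have h := measureReal_le_sum_le_exp hlaw hindep hm
    (M.integrable_dataLaw μ hm.exp) hc (n * t)
  convert h using 2
  · ext ω
    simp only [Set.mem_ofPred_eq, ← mul_sum, M.sum_lossDiff hn f' f π fun i => D i ω]
    rw [mul_left_comm, mul_le_mul_iff_right₀ hn']
  · ring

/-- With `l = 1 / Vmax²` the Hoeffding exponent falls short of `2a² / Vmax²` by `(a + b)² / (2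
Vmax²)`, so `b` drops out and `Real.exp_two_mul_le` applies. -/
lemma measureReal_le_loss_sub_le (M : MDP S A) {μ : PMF (S × A)}
    (hlaw : ∀ i, HasLaw (D i) (M.dataLaw μ) Pr) (hindep : iIndepFun D Pr) (hn : 0 < n)
    (hV : 0 < M.Vmax) {f f' : S × A → ℝ} (hf : ∀ x, f x ∈ Set.Icc 0 M.Vmax) (π : Policy S A)
    (t : ℝ) :
    Pr.real {ω | t ≤ M.loss f f π (fun i => D i ω) - M.loss f' f π (fun i => D i ω)} ≤
      Real.exp (n * (7 * sqNorm (fun x => (μ x).toReal) (f - M.bellman π f) - t)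
        / M.Vmax ^ 2) := by
  have hV2 : 0 < M.Vmax ^ 2 := by positivity
  have h := M.measureReal_le_mul_loss_sub_le (f' := f') hlaw hindep hn hf π (1 / M.Vmax ^ 2)
    (7 / M.Vmax ^ 2) 0 (t / M.Vmax ^ 2) fun x => by
      have hu := M.sq_sub_bellman_div_mem_Icc π hf hf x
      set a := (f - M.bellman π f) x
      set b := (f' - M.bellman π f) x
      have h2 := Real.exp_two_mul_le hu.1 hu.2
      refine (Real.exp_le_exp.2 ?_).trans (h2.trans (le_of_eq (by ring)))
      rw [← sub_nonneg]
      have : 2 * (a ^ 2 / M.Vmax ^ 2) - (1 / M.Vmax ^ 2 * (a ^ 2 - b ^ 2) +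
          (1 / M.Vmax ^ 2) ^ 2 * (a - b) ^ 2 * M.Vmax ^ 2 / 2) =
          (a + b) ^ 2 / 2 / M.Vmax ^ 2 := by
        field_simp; ring
      rw [this]; positivity
  convert h using 2
  · ext ω
    simp only [Set.mem_ofPred_eq]
    rw [one_div_mul_eq_div, div_le_div_iff_of_pos_right hV2]
  · field_simp; ring

/-- With `l = -1 / (2 Vmax²)` the Hoeffding exponent falls short of `(3b² - a²) / (4 Vmax²)` by `(a
+ b)² / (8 Vmax²)`. The negative weight left on `a²` makes a large Bellman error detectable. -/
lemma measureReal_loss_sub_le_le (M : MDP S A) {μ : PMF (S × A)}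
    (hlaw : ∀ i, HasLaw (D i) (M.dataLaw μ) Pr) (hindep : iIndepFun D Pr) (hn : 0 < n)
    (hV : 0 < M.Vmax) {f f' : S × A → ℝ} (hf : ∀ x, f x ∈ Set.Icc 0 M.Vmax)
    (hf' : ∀ x, f' x ∈ Set.Icc 0 M.Vmax) (π : Policy S A) (t : ℝ) :
    Pr.real {ω | M.loss f f π (fun i => D i ω) - M.loss f' f π (fun i => D i ω) ≤ t} ≤
      Real.exp (n * (21 / 16 * sqNorm (fun x => (μ x).toReal) (f' - M.bellman π f)
        - 3 / 16 * sqNorm (fun x => (μ x).toReal) (f - M.bellman π f) + t / 2)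
        / M.Vmax ^ 2) := by
  have hV2 : 0 < M.Vmax ^ 2 := by positivity
  have h := M.measureReal_le_mul_loss_sub_le (f' := f') hlaw hindep hn hf π
    (-(1 / (2 * M.Vmax ^ 2))) (-(3 / 16) / M.Vmax ^ 2) (21 / 16 / M.Vmax ^ 2)
    (-(1 / (2 * M.Vmax ^ 2)) * t) fun x => by
      have hu := M.sq_sub_bellman_div_mem_Icc π hf hf x
      have hv := M.sq_sub_bellman_div_mem_Icc π hf hf' x
      set a := (f - M.bellman π f) x
      set b := (f' - M.bellman π f) x
      have h2 := Real.exp_three_mul_sub_div_four_le hu.1 hu.2 hv.1 hv.2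
      refine (Real.exp_le_exp.2 ?_).trans (h2.trans (le_of_eq (by ring)))
      rw [← sub_nonneg]
      have : (3 * (b ^ 2 / M.Vmax ^ 2) - a ^ 2 / M.Vmax ^ 2) / 4 -
          (-(1 / (2 * M.Vmax ^ 2)) * (a ^ 2 - b ^ 2) +
          (-(1 / (2 * M.Vmax ^ 2))) ^ 2 * (a - b) ^ 2 * M.Vmax ^ 2 / 2) =
          (a + b) ^ 2 / 8 / M.Vmax ^ 2 := by
        field_simp; ring
      rw [this]; positivity
  convert h using 2
  · ext ω
    simp only [Set.mem_ofPred_eq]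
    rw [mul_le_mul_left_of_neg (by simp; positivity)]
  · field_simp; ring

end Concentration

end MDP

namespace MDP

/-! ### Version spaces and their error level. -/

section VersionSpace

variable {S A : Type*}

/-- The bound on the squared Bellman errors over the version spaces. -/
def versionSpaceError (M : MDP S A) (n : ℕ) (l εF εFF : ℝ) : ℝ :=
  400 * (M.Vmax ^ 2 * (l / n)) + 104 * (εFF + εF)

lemma sqrt_versionSpaceError_le (M : MDP S A) (π : Policy S A) {n : ℕ} {l εF εFF : ℝ}
    (hl : 0 ≤ l) (hεF : 0 ≤ εF) (hεFF : 0 ≤ εFF) :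
    √(M.versionSpaceError n l εF εFF) ≤ 20 * (M.Vmax * √(l / n)) + 11 * √(εFF + εF) := by
  have hV := M.Vmax_nonneg π
  refine Real.sqrt_le_iff.2 ⟨by positivity, ?_⟩
  have h1 := Real.sq_sqrt (show 0 ≤ l / n by positivity)
  have h2 := Real.sq_sqrt (show 0 ≤ εFF + εF by positivity)
  have h3 : 0 ≤ M.Vmax * √(l / n) * √(εFF + εF) := by positivity
  rw [versionSpaceError]
  nth_rewrite 1 [← h1, ← h2]
  -- Here `400 = 20²` and `104 ≤ 11²`; the cross term is nonnegative.
  nlinarith [sq_nonneg √(εFF + εF)]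

variable [Fintype A]

lemma mem_versionSpace_iff (M : MDP S A) {F : Finset (S × A → ℝ)} (hF : F.Nonempty)
    {f : S × A → ℝ} {π : Policy S A} {ε : ℝ} {n : ℕ} {D : Dataset S A n} :
    f ∈ M.versionSpace F hF π ε D ↔ f ∈ F ∧ ∀ f' ∈ F, M.loss f f π D - M.loss f' f π D ≤ ε := by
  refine and_congr_right fun _ => ?_
  rw [empBellmanError, sub_le_comm, Finset.le_inf'_iff]
  simp_rw [sub_le_comm]

variable [Fintype S]

lemma Completeness.exists_mem {M : MDP S A} {μ : PMF (S × A)} {F : Finset (S × A → ℝ)}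
    {hF : F.Nonempty} {Pi : Finset (Policy S A)} {εFF : ℝ}
    (h : M.Completeness μ F hF Pi εFF) {π : Policy S A} (hπ : π ∈ Pi) {f : S × A → ℝ}
    (hf : f ∈ F) : ∃ f' ∈ F, sqNorm (fun x => (μ x).toReal) (f' - M.bellman π f) ≤ εFF :=
  (Finset.inf'_le_iff _).1 ((Finset.sup'_le_iff _ _).1 (h π hπ) f hf)

end VersionSpace

/-! ### Pessimism and the high-probability event. -/

section Pessimism

variable {S A : Type*} [Fintype S] [Fintype A] [MeasurableSpace S] [MeasurableSingletonClass S]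
  [MeasurableSpace A] [MeasurableSingletonClass A]

lemma J_eq_zero (M : MDP S A) (π : Policy S A) (hV : M.Vmax = 0) : M.J π = 0 := by
  have h := M.Rmax_add_mul_Vmax
  rw [hV, mul_zero, add_zero] at h
  have hR : ∀ s a, M.R s a = 0 := fun s a =>
    le_antisymm ((M.R_mem s a).2.trans h.le) (M.R_mem s a).1
  simp [J, hR]

/-- Pessimism: the loss against a policy `πb` is controlled by the Bellman errors on the
version space of `πb` under `πb` itself. -/
lemma J_sub_J_le (M : MDP S A) {F : Finset (S × A → ℝ)} {hF : F.Nonempty}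
    {Pi : Finset (Policy S A)} {ε : ℝ} {n : ℕ} {D : Dataset S A n} {πb πhat : Policy S A}
    (hπb : πb ∈ Pi) (hhat : M.IsPessimisticPolicy F hF Pi ε D πhat) {e b : ℝ}
    {f : S × A → ℝ} (hf : f ∈ M.versionSpace F hF πhat ε D)
    (hfe : sqNorm (M.occupancy πhat) (f - M.bellman πhat f) ≤ e)
    (hb : ∀ g ∈ M.versionSpace F hF πb ε D,
      sqNorm (M.occupancy πb) (g - M.bellman πb g) ≤ b) :
    M.J πb - M.J πhat ≤ √b / (1 - M.γ) + √e / (1 - M.γ) := by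
  -- If the version space of `πb` is empty, its value is `⊤` and the bound is vacuous.
  have h1 : ((M.J πb - √b / (1 - M.γ) : ℝ) : EReal) ≤ M.pessimisticValue F hF πb ε D := by
    refine le_iInf₂ fun g hg => EReal.coe_le_coe_iff.2 ?_
    linarith [(abs_le.1 (M.abs_valueAt_sub_J_le πb g (hb g hg))).1]
  have h2 : M.pessimisticValue F hF πhat ε D ≤ ((valueAt f M.s₀ πhat : ℝ) : EReal) :=
    iInf₂_le f hf
  have h3 := EReal.coe_le_coe_iff.1 (h1.trans ((hhat.2 πb hπb).trans h2))
  linarith [(abs_le.1 (M.abs_valueAt_sub_J_le πhat f hfe)).2]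

lemma Realizability.exists_mem {M : MDP S A} {F : Finset (S × A → ℝ)} {hF : F.Nonempty}
    {Pi : Finset (Policy S A)} {hPi : Pi.Nonempty} {εF : ℝ}
    (h : M.Realizability F hF Pi hPi εF) {π : Policy S A} (hπ : π ∈ Pi) :
    ∃ f ∈ F, ∀ π' ∈ Pi, sqNorm (M.occupancy π') (f - M.bellman π f) ≤ εF := by
  obtain ⟨f, hf, h'⟩ := (Finset.inf'_le_iff _).1 (h π hπ)
  exact ⟨f, hf, (Finset.sup'_le_iff _ _).1 h'⟩

variable {Ω : Type*} [MeasurableSpace Ω] {Pr : Measure Ω} [IsProbabilityMeasure Pr] {n : ℕ}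
  {D : Fin n → Ω → S × A × ℝ × S}

/-- With high probability, the version spaces contain prescribed near-solutions of the Bellman
equation, and consist of functions with small Bellman error. -/
lemma exists_measureReal_le (M : MDP S A) {μ : PMF (S × A)}
    (hlaw : ∀ i, HasLaw (D i) (M.dataLaw μ) Pr) (hindep : iIndepFun D Pr) (hn : 0 < n)
    (hV : 0 < M.Vmax) {F : Finset (S × A → ℝ)} (hF : F.Nonempty)
    (hFrange : ∀ f ∈ F, ∀ x, f x ∈ Set.Icc 0 M.Vmax) {Pi : Finset (Policy S A)}
    {εF εFF δ : ℝ} (hεF : 0 ≤ εF) (hcomp : M.Completeness μ F hF Pi εFF)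
    {fstar : Policy S A → S × A → ℝ} (hmem : ∀ π ∈ Pi, fstar π ∈ F)
    (hstar : ∀ π ∈ Pi, sqNorm (fun x => (μ x).toReal) (fstar π - M.bellman π (fstar π)) ≤ εF)
    (hl : 0 ≤ Real.log ((#F : ℝ) * (#Pi : ℝ) / δ)) :
    ∃ bad : Set Ω, Pr.real bad ≤
        #Pi * #F * (2 * Real.exp (-2 * Real.log ((#F : ℝ) * (#Pi : ℝ) / δ))) ∧
      ∀ ω ∉ bad, ∀ π ∈ Pi,
        fstar π ∈ M.versionSpace F hF π (M.epsR F Pi n δ εF) (fun i => D i ω) ∧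
        ∀ f ∈ M.versionSpace F hF π (M.epsR F Pi n δ εF) (fun i => D i ω),
          sqNorm (fun x => (μ x).toReal) (f - M.bellman π f) ≤
            M.versionSpaceError n (Real.log ((#F : ℝ) * (#Pi : ℝ) / δ)) εF εFF := by
  set l := Real.log ((#F : ℝ) * (#Pi : ℝ) / δ)
  set r := M.epsR F Pi n δ εF
  have hr : r = 139 * (M.Vmax ^ 2 * (l / n)) + 39 * εF := by simp only [r, epsR, l]; ring
  have hn' : (0 : ℝ) < n := by positivity
  have hV2 : 0 < M.Vmax ^ 2 := by positivity
  have hw : 0 ≤ M.Vmax ^ 2 * (l / n) := by positivity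
  have hexp : ∀ y : ℝ, y ≤ -2 * (M.Vmax ^ 2 * (l / n)) →
      Real.exp (n * y / M.Vmax ^ 2) ≤ Real.exp (-2 * l) := fun y hy => by
    rw [Real.exp_le_exp, div_le_iff₀ hV2]
    calc n * y ≤ n * (-2 * (M.Vmax ^ 2 * (l / n))) := by gcongr
      _ = -2 * l * M.Vmax ^ 2 := by field_simp
  choose! g hgF hg using fun π (hπ : π ∈ Pi) f (hf : f ∈ F) => hcomp.exists_mem hπ hf
  -- `bad₁` needs every competitor in `F`, since the empirical minimum runs over `F`. `bad₂` uses
  -- only the completeness witness `g π f`, so both families are indexed by pairs.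
  let bad₁ : Policy S A × (S × A → ℝ) → Set Ω := fun p =>
    {ω | r ≤ M.loss (fstar p.1) (fstar p.1) p.1 (fun i => D i ω)
      - M.loss p.2 (fstar p.1) p.1 (fun i => D i ω)}
  let bad₂ : Policy S A × (S × A → ℝ) → Set Ω := fun p =>
    {ω | M.versionSpaceError n l εF εFF <
        sqNorm (fun x => (μ x).toReal) (p.2 - M.bellman p.1 p.2) ∧
      M.loss p.2 p.2 p.1 (fun i => D i ω) - M.loss (g p.1 p.2) p.2 p.1 (fun i => D i ω) ≤ r}
  have h₁ : ∀ p ∈ Pi ×ˢ F, Pr.real (bad₁ p) ≤ Real.exp (-2 * l) := fun p hp => by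
    rw [mem_product] at hp
    refine (M.measureReal_le_loss_sub_le hlaw hindep hn hV (hFrange _ (hmem _ hp.1)) p.1 r).trans
      (hexp _ ?_)
    linarith [hstar p.1 hp.1]
  have h₂ : ∀ p ∈ Pi ×ˢ F, Pr.real (bad₂ p) ≤ Real.exp (-2 * l) := fun p hp => by
    rw [mem_product] at hp
    by_cases hlt : M.versionSpaceError n l εF εFF <
        sqNorm (fun x => (μ x).toReal) (p.2 - M.bellman p.1 p.2)
    · simp only [bad₂, hlt, true_and]
      refine (M.measureReal_loss_sub_le_le hlaw hindep hn hV (hFrange _ hp.2)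
        (hFrange _ (hgF _ hp.1 _ hp.2)) p.1 r).trans (hexp _ ?_)
      rw [versionSpaceError] at hlt
      have hFF := hg _ hp.1 _ hp.2
      have hFF₀ : 0 ≤ εFF := (sqNorm_nonneg (fun _ => ENNReal.toReal_nonneg) _).trans hFF
      -- The threshold contributes `r / 2`; its `εF` part cancels exactly, as `3/16 * 104 = 39/2`,
      -- and `3/16 * 400 = 75` exceeds `139/2 + 2`.
      linarith
    · simp [bad₂, hlt, Real.exp_nonneg]
  refine ⟨⋃ p ∈ Pi ×ˢ F, bad₁ p ∪ bad₂ p, ?_, fun ω hω π hπ => ?_⟩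
  · calc _ ≤ ∑ p ∈ Pi ×ˢ F, Pr.real (bad₁ p ∪ bad₂ p) := measureReal_biUnion_finset_le _ _
      _ ≤ ∑ p ∈ Pi ×ˢ F, 2 * Real.exp (-2 * l) := sum_le_sum fun p hp => by
        linarith [measureReal_union_le (μ := Pr) (bad₁ p) (bad₂ p), h₁ p hp, h₂ p hp]
      _ = _ := by rw [sum_const, card_product, nsmul_eq_mul, Nat.cast_mul]
  · simp only [Set.mem_iUnion, not_exists, Set.mem_union, not_or, mem_product] at hω
    refine ⟨(M.mem_versionSpace_iff hF).2 ⟨hmem π hπ, fun f' hf' => ?_⟩, fun f hf => ?_⟩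
    · exact (not_le.1 (hω (π, f') ⟨hπ, hf'⟩).1).le
    · rw [mem_versionSpace_iff] at hf
      by_contra hlt
      exact (hω (π, f) ⟨hπ, hf.1⟩).2 ⟨not_le.1 hlt, hf.2 _ (hgF π hπ f hf.1)⟩

end Pessimism

end MDP

end

/-! ### The main theorem. -/

theorem mainTheorem4 :
    ∃ C : ℝ, 0 < C ∧
      ∀ {S A : Type*} [Fintype S] [Fintype A] [MeasurableSpace S] [MeasurableSingletonClass S]
        [MeasurableSpace A] [MeasurableSingletonClass A]
        (M : MDP S A)
        (F : Finset (S × A → ℝ)) (hF : F.Nonempty)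
        (_hFrange : ∀ f ∈ F, ∀ x, f x ∈ Set.Icc 0 M.Vmax)
        (Pi : Finset (Policy S A)) (hPi : Pi.Nonempty)
        (πb : Policy S A) (_hπb : πb ∈ Pi)
        (μ : PMF (S × A)) (_hμ : ∀ x, (μ x).toReal = M.occupancy πb x)
        (εF εFF : ℝ)
        (_hreal : M.Realizability F hF Pi hPi εF)
        (_hcomp : M.Completeness μ F hF Pi εFF)
        (n : ℕ) (_hn : 0 < n) (δ : ℝ) (_hδ₀ : 0 < δ) (_hδ₁ : δ < 1)
        {Ω : Type*} [MeasurableSpace Ω] (Pr : Measure Ω) [IsProbabilityMeasure Pr]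
        (D : Fin n → Ω → S × A × ℝ × S)
        (_hlaw : ∀ i, HasLaw (D i) (M.dataLaw μ) Pr)
        (_hindep : iIndepFun D Pr),
        ENNReal.ofReal (1 - δ) ≤
          Pr {ω | ∀ πhat : Policy S A,
            M.IsPessimisticPolicy F hF Pi (M.epsR F Pi n δ εF) (fun i => D i ω) πhat →
              M.J πb - M.J πhat ≤
                C * (M.Vmax / (1 - M.γ) * √(Real.log ((#F : ℝ) * (#Pi : ℝ) / δ) / n)
                  + √(εFF + εF) / (1 - M.γ))} := by
  refine ⟨20, by norm_num, ?_⟩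
  intro S A _ _ _ _ _ _ M F hF hFrange Pi hPi πb hπb μ hμ εF εFF hreal hcomp n hn δ hδ₀ hδ₁
    Ω _ Pr _ D hlaw hindep
  have hγ : 0 < 1 - M.γ := by linarith [M.γ_lt_one]
  have hV := M.Vmax_nonneg πb
  have hμ' : (fun x => (μ x).toReal) = M.occupancy πb := funext hμ
  have hF1 : (1 : ℝ) ≤ #F := by exact_mod_cast hF.card_pos
  have hPi1 : (1 : ℝ) ≤ #Pi := by exact_mod_cast hPi.card_pos
  have hpos : 0 ≤ 20 * (M.Vmax / (1 - M.γ) * √(Real.log ((#F : ℝ) * (#Pi : ℝ) / δ) / n)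
      + √(εFF + εF) / (1 - M.γ)) := by positivity
  -- Discarding the case where no policy is worse than `πb` forces `Vmax > 0` and `#Pi ≥ 2`. The
  -- latter absorbs the factor 2 of the union bound: its total is `2δ² / N ≤ δ` with `N = #F * #Pi ≥
  -- 2`.
  by_cases htriv : ∀ π ∈ Pi, M.J πb - M.J π ≤ 0
  · rw [Set.eq_univ_of_forall (s := {ω | _}) fun ω πhat h => (htriv πhat h.1).trans hpos,
      measure_univ]
    exact ENNReal.ofReal_le_one.2 (by linarith)
  have hV' : 0 < M.Vmax := hV.lt_of_ne' fun h =>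
    htriv fun π _ => by rw [M.J_eq_zero _ h, M.J_eq_zero _ h, sub_zero]
  have hPi2 : (2 : ℝ) ≤ #Pi := by
    push Not at htriv
    obtain ⟨π, hπ, hJ⟩ := htriv
    have : 1 < #Pi := one_lt_card.2 ⟨π, hπ, πb, hπb, fun h => by simp [h] at hJ⟩
    exact_mod_cast this
  choose! fstar hmem hstar using fun π (hπ : π ∈ Pi) => hreal.exists_mem hπ
  have hεF : 0 ≤ εF := (MDP.sqNorm_nonneg (M.occupancy_nonneg πb) _).trans (hstar πb hπb πb hπb)
  have hεFF : 0 ≤ εFF := by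
    obtain ⟨f, hf⟩ := hF
    obtain ⟨f', -, h⟩ := hcomp.exists_mem hπb hf
    exact (MDP.sqNorm_nonneg (fun _ => ENNReal.toReal_nonneg) _).trans h
  have hN : 2 ≤ (#F : ℝ) * #Pi := by nlinarith
  have hl : 0 ≤ Real.log ((#F : ℝ) * (#Pi : ℝ) / δ) :=
    Real.log_nonneg ((one_le_div hδ₀).2 (by linarith))
  obtain ⟨bad, hbad, hgood⟩ := M.exists_measureReal_le hlaw hindep hn hV' hF hFrange hεF hcomp
    hmem (fun π hπ => hμ' ▸ hstar π hπ πb hπb) hl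
  have hbad' : Pr.real bad ≤ δ := by
    refine hbad.trans ?_
    have h0 : 0 < (#F : ℝ) * #Pi / δ := by positivity
    have : Real.exp (-2 * Real.log ((#F : ℝ) * (#Pi : ℝ) / δ)) = (((#F : ℝ) * #Pi / δ) ^ 2)⁻¹ := by
      rw [neg_mul, Real.exp_neg, two_mul, Real.exp_add, Real.exp_log h0, sq]
    rw [this, mul_comm (#Pi : ℝ)]
    set N := (#F : ℝ) * #Pi
    calc N * (2 * ((N / δ) ^ 2)⁻¹) = 2 / N * δ * δ := by field_simp
      _ ≤ 1 * 1 * δ := by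
        gcongr
        exact (div_le_one (by linarith)).2 hN
      _ = δ := by ring
  set good := {ω | ∀ πhat : Policy S A, _}
  have hsub : badᶜ ⊆ good := fun ω hω πhat hhat => by
    have hv := hgood ω hω
    have h := M.J_sub_J_le hπb hhat (hv πhat hhat.1).1 (hstar πhat hhat.1 πhat hhat.1)
      (hμ' ▸ (hv πb hπb).2)
    refine h.trans ?_
    rw [← add_div, div_mul_eq_mul_div, ← add_div, ← mul_div_assoc]
    gcongr
    have h1 := M.sqrt_versionSpaceError_le πb (n := n) hl hεF hεFF
    have h2 : √εF ≤ √(εFF + εF) := Real.sqrt_le_sqrt (by linarith)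
    -- The approximation terms add up to `11 + 1 ≤ 20`.
    linarith [Real.sqrt_nonneg (εFF + εF)]
  -- Subadditivity of the outer measure suffices, so neither `bad` nor `good` has to be measurable.
  have h1 : (1 : ENNReal) ≤ Pr bad + Pr good := by
    rw [← measure_univ (μ := Pr), ← Set.union_compl_self bad]
    exact (measure_union_le _ _).trans (by gcongr)
  rw [ENNReal.ofReal_sub _ hδ₀.le, ENNReal.ofReal_one]
  refine tsub_le_iff_left.2 (h1.trans ?_)
  gcongr
  rw [← ofReal_measureReal]
  exact ENNReal.ofReal_le_ofReal hbad'
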